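/- **Theorem (Bound on the Rademacher complexity of log-Barron balls).** For $d\ge 1$ and $\xi\in\mathbb{R}^d$ write $|\xi|_1=\sum_j|\xi^{(j)}|$, $|\xi|_\infty=\max_j|\xi^{(j)}|$. For a tempered distribution $f$ on $\mathbb{R}^d$ whose Fourier transform $\hat f$ (normalized as $\hat f(\xi)=\int f(x)e^{-2\pi i\xi\cdot x}\,dx$) is a locally integrable function, let $$\|f\|_{\mathscr{B}^{\log}}=\int_{\mathbb{R}^d}\log_2(2+|\xi|_1)\,|\hat f(\xi)|\,d\xi\in[0,\infty],$$ and let $\|f\|_{\mathscr{B}^{\log}}=\infty$ if $\hat f$ is not a function. Let $\mathscr{B}^{\log}$ be the set of tempered distributions $f$ with $\|f\|_{\mathscr{B}^{\log}}<\infty$; every such $f$ is given by a unique continuous function, and $f(x)$ denotes the value of this function at $x$. For $Q\ge 0$ put $\mathcal{F}_Q=\{f\in\mathscr{B}^{\log}:\|f\|_{\mathscr{B}^{\log}}\le Q\}$, and for $x_1,\dots,x_n\in\mathbb{R}^d$, $n\ge 1$, define the empirical Rademacher complexity $$\mathcal{R}_n(\mathcal{F}_Q)=\mathbb{E}_\sigma\Big[\sup_{f\in\mathcal{F}_Q}\frac1n\sum_{i=1}^n\sigma_i\,\operatorname{Re}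 f(x_i)\Big],$$ where $\sigma_1,\dots,\sigma_n$ are independent with $\mathbb{P}(\sigma_i=1)=\mathbb{P}(\sigma_i=-1)=\tfrac12$. There is an absolute constant $C>0$ such that for all $d,n\ge 1$, all $Q\ge 0$ and all $x_1,\dots,x_n\in\mathbb{R}^d$ with $|x_i|_\infty\le 1$, the supremum above is finite for every choice of signs and $$\mathcal{R}_n(\mathcal{F}_Q)\le C\,Q\,\sqrt{\frac dn}.$$ -/

import Mathlib

open MeasureTheory SchwartzMap FourierTransform
open scoped ENNReal ContDiff

/-- The tempered distribution `T` on `ℝ^d` is (the regular distribution of) the function `g`: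
`T φ = ∫ φ g` for every Schwartz function `φ`. -/
def IsGivenBy {d : ℕ} (T : 𝓢'(EuclideanSpace ℝ (Fin d), ℂ))
    (g : EuclideanSpace ℝ (Fin d) → ℂ) : Prop :=
  LocallyIntegrable g ∧
    ∀ φ : 𝓢(EuclideanSpace ℝ (Fin d), ℂ),
      Integrable (fun ξ => φ ξ * g ξ) ∧ T φ = ∫ ξ, φ ξ * g ξ

/-- A function that gives a tempered distribution is unique up to null sets. -/
theorem IsGivenBy.ae_eq {d : ℕ} {T : 𝓢'(EuclideanSpace ℝ (Fin d), ℂ)}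
    {g h : EuclideanSpace ℝ (Fin d) → ℂ} (hg : IsGivenBy T g) (hh : IsGivenBy T h) :
    g =ᵐ[volume] h := by
  refine ae_eq_of_integral_contDiff_smul_eq hg.1 hh.1 fun φ hφ hsupp => ?_
  have h1 : HasCompactSupport (fun x => (φ x : ℂ)) :=
    hsupp.comp_left (g := fun r : ℝ => (r : ℂ)) Complex.ofReal_zero
  have h2 : ContDiff ℝ ∞ (fun x => (φ x : ℂ)) := Complex.ofRealCLM.contDiff.comp hφ
  have hG := (hg.2 (h1.toSchwartzMap h2)).2
  have hH := (hh.2 (h1.toSchwartzMap h2)).2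
  have := hG.symm.trans hH
  simpa [Complex.real_smul] using this

/-- The weight `log₂ (2 + |ξ|₁)`. -/
noncomputable def logWeight {d : ℕ} (ξ : EuclideanSpace ℝ (Fin d)) : ℝ :=
  Real.logb 2 (2 + ∑ j, |ξ j|)

/-- The log-Barron norm `∫ log₂ (2 + |ξ|₁) |f̂ ξ| dξ` of a tempered distribution `f`, with value
`∞` if the distributional Fourier transform `f̂` is not a function. The infimum runs over the
functions that give `f̂`; they agree almost everywhere, so all of them yield the same integral. -/
noncomputable def logBarronNorm {d : ℕ} (f : 𝓢'(EuclideanSpace ℝ (Fin d), ℂ)) : ℝ≥0∞ :=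
  ⨅ (g : EuclideanSpace ℝ (Fin d) → ℂ) (_ : IsGivenBy (𝓕 f) g),
    ∫⁻ ξ, ENNReal.ofReal (logWeight ξ) * ‖g ξ‖ₑ

theorem logBarronNorm_eq {d : ℕ} {f : 𝓢'(EuclideanSpace ℝ (Fin d), ℂ)}
    {g : EuclideanSpace ℝ (Fin d) → ℂ} (hg : IsGivenBy (𝓕 f) g) :
    logBarronNorm f = ∫⁻ ξ, ENNReal.ofReal (logWeight ξ) * ‖g ξ‖ₑ := by
  refine le_antisymm (iInf₂_le g hg) (le_iInf₂ fun h hh => le_of_eq (lintegral_congr_ae ?_))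
  filter_upwards [hg.ae_eq hh] with ξ hξ
  rw [hξ]

/-- The log-Barron space. -/
def logBarronSpace (d : ℕ) : Set 𝓢'(EuclideanSpace ℝ (Fin d), ℂ) :=
  {f | logBarronNorm f < ⊤}

theorem one_le_logWeight {d : ℕ} (ξ : EuclideanSpace ℝ (Fin d)) : 1 ≤ logWeight ξ := by
  have h0 : 0 ≤ ∑ j, |ξ j| := Finset.sum_nonneg fun j _ => abs_nonneg _
  unfold logWeight
  rw [Real.le_logb_iff_rpow_le (by norm_num) (by linarith)]
  simpa using h0

/-- Every element of the log-Barron space is given by exactly one continuous function; the point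
values of the element are the values of this function. -/
theorem existsUnique_continuous_of_mem_logBarronSpace {d : ℕ}
    {f : 𝓢'(EuclideanSpace ℝ (Fin d), ℂ)} (hf : f ∈ logBarronSpace d) :
    ∃! u : EuclideanSpace ℝ (Fin d) → ℂ, Continuous u ∧ IsGivenBy f u := by
  obtain ⟨g, hg⟩ : ∃ g, IsGivenBy (𝓕 f) g := by
    by_contra hne
    push Not at hne
    have : logBarronNorm f = ⊤ := by simp [logBarronNorm, hne]
    exact (ne_of_lt hf) this
  have hfin : ∫⁻ ξ, ENNReal.ofReal (logWeight ξ) * ‖g ξ‖ₑ < ⊤ := logBarronNorm_eq hg ▸ hf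
  have hint : Integrable g := by
    refine ⟨hg.1.aestronglyMeasurable, lt_of_le_of_lt (lintegral_mono fun ξ => ?_) hfin⟩
    calc ‖g ξ‖ₑ = 1 * ‖g ξ‖ₑ := (one_mul _).symm
      _ ≤ _ := by
        gcongr
        simpa using one_le_logWeight ξ
  have hcont : Continuous (𝓕⁻ g) := by
    have h : Continuous (𝓕 g) := VectorFourier.fourierIntegral_continuous
      Real.continuous_fourierChar (by exact continuous_inner) hint
    have he : 𝓕⁻ g = fun x => 𝓕 g (-x) := funext fun x => Real.fourierInv_eq_fourier_neg g x
    rw [he]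
    exact h.comp continuous_neg
  have hbdd : ∀ x, ‖𝓕⁻ g x‖ ≤ ∫ ξ, ‖g ξ‖ := fun x => by
    rw [Real.fourierInv_eq_fourier_neg]
    exact VectorFourier.norm_fourierIntegral_le_integral_norm _ _ _ _ _
  have hrep : IsGivenBy f (𝓕⁻ g) := by
    refine ⟨hcont.locallyIntegrable, fun φ => ⟨?_, ?_⟩⟩
    · exact φ.integrable.mul_bdd hcont.aestronglyMeasurable (Filter.Eventually.of_forall hbdd)
    · have h1 : f φ = 𝓕 f (𝓕⁻ φ) := by simp
      rw [h1, (hg.2 _).2, SchwartzMap.fourierInv_coe]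
      calc ∫ ξ, 𝓕⁻ (φ : EuclideanSpace ℝ (Fin d) → ℂ) ξ * g ξ
          = ∫ ξ, 𝓕 (fun x => φ (-x)) ξ * g ξ := by rw [Real.fourierInv_eq_fourier_comp_neg]
        _ = ∫ x, φ (-x) * 𝓕 g x := by
          have := VectorFourier.integral_fourierIntegral_smul_eq_flip
            (μ := volume) (ν := volume) (L := innerₗ (EuclideanSpace ℝ (Fin d)))
            Real.continuous_fourierChar continuous_inner φ.integrable.comp_neg hint
          simp only [flip_innerₗ, smul_eq_mul] at this
          exact this
        _ = ∫ x, φ x * 𝓕⁻ g x := by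
          rw [← integral_neg_eq_self (fun x => φ x * 𝓕⁻ g x)]
          simp [Real.fourierInv_eq_fourier_neg]
  exact ⟨𝓕⁻ g, ⟨hcont, hrep⟩, fun v hv =>
    (hv.1.ae_eq_iff_eq volume hcont).1 (hv.2.ae_eq hrep)⟩

/-- The values on `ℝ^d` of the ball `{f ∈ 𝓑^log : ‖f‖ ≤ Q}` of the log-Barron space: the continuous
functions that give an element of the ball. -/
def logBarronBall (d : ℕ) (Q : ℝ) : Set (EuclideanSpace ℝ (Fin d) → ℂ) :=
  {u | Continuous u ∧ ∃ f ∈ logBarronSpace d, logBarronNorm f ≤ ENNReal.ofReal Q ∧ IsGivenBy f u}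

/-- The quantities `(1 / n) ∑ i, σ i * u (x i)`, `u ∈ F`, for a sign vector `σ`. The functions may be
complex-valued; the real part is taken (it changes nothing for a real-valued `u`). -/
def signedAverages {d n : ℕ} (F : Set (EuclideanSpace ℝ (Fin d) → ℂ))
    (x : Fin n → EuclideanSpace ℝ (Fin d)) (σ : Fin n → ℤˣ) : Set ℝ :=
  {r | ∃ u ∈ F, r = (1 / n : ℝ) * ∑ i, ((σ i : ℤ) : ℝ) * (u (x i)).re}

/-- The empirical Rademacher complexity `𝔼_σ sup_{u ∈ F} (1 / n) ∑ i, σ i * u (x i)`. The `σ i` are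
independent uniform signs, that is, `σ` is uniformly distributed on the `2 ^ n` sign vectors. -/
noncomputable def empiricalRademacher {d n : ℕ} (F : Set (EuclideanSpace ℝ (Fin d) → ℂ))
    (x : Fin n → EuclideanSpace ℝ (Fin d)) : ℝ :=
  (1 / 2 ^ n : ℝ) * ∑ σ : Fin n → ℤˣ, sSup (signedAverages F x σ)

/-! A function in the ball is a Fourier integral, so its signed sum is at most `Q` times the
supremum over `ξ` of the signed sum of plane waves divided by `logWeight ξ`. It remains to control
all frequencies at once, with expectation of order `√(dn)`.

Frequencies are rounded to the lattice of mesh `1/d`. As `|x i j| ≤ 1`, Taylor expansion around a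
lattice point writes the wave through coefficient vectors bounded by 1 with total weight `e^{2π}`,
independently of `d` (`enorm_signedSum_planeWave_le`, `tsum_taylorWeight`). This leaves countably
many subgaussian sums.

The union bound is soft: `y ≤ p + exp (y - p)`, where `p` is the penalty of the lattice point and
`y` is `s` times a signed sum. Penalties are large enough for `∑ exp (-p)` to absorb the exponential
moments (`sum_waveExcess_le`). By Jensen they are still at most a multiple of `d * logWeight ξ`
(`latticePenalty_le`). The choice `s = √(d/n)` balances the two contributions. -/

/-! ### Exponential moments of Rademacher sums. -/

/-- The signed sum `∑ i, σ i * a i`. -/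
noncomputable def signedSum {n : ℕ} (σ : Fin n → ℤˣ) (a : Fin n → ℂ) : ℂ :=
  ∑ i, ((σ i : ℤ) : ℂ) * a i

theorem sum_units_int (f : ℤˣ → ℝ) : ∑ ε, f ε = f 1 + f (-1) := by
  have : (Finset.univ : Finset ℤˣ) = {1, -1} := by decide
  rw [this, Finset.sum_pair (by decide)]

/-- Real Rademacher sums are subgaussian. -/
theorem sum_exp_signed_le {n : ℕ} (t : ℝ) (a : Fin n → ℝ) (ha : ∀ i, |a i| ≤ 1) :
    ∑ σ : Fin n → ℤˣ, Real.exp (t * ∑ i, ((σ i : ℤ) : ℝ) * a i)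
      ≤ 2 ^ n * Real.exp (t ^ 2 * n / 2) := by
  calc ∑ σ : Fin n → ℤˣ, Real.exp (t * ∑ i, ((σ i : ℤ) : ℝ) * a i)
      = ∏ i, ∑ ε : ℤˣ, Real.exp (t * (((ε : ℤ) : ℝ) * a i)) := by
        rw [Fintype.prod_sum]
        exact Finset.sum_congr rfl fun σ _ => by rw [Finset.mul_sum, Real.exp_sum]
    _ = ∏ i, (2 * Real.cosh (t * a i)) := by
        refine Finset.prod_congr rfl fun i _ => ?_
        rw [sum_units_int, Real.cosh_eq]
        simp
        ring
    _ ≤ ∏ _i : Fin n, (2 * Real.exp (t ^ 2 / 2)) := by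
        refine Finset.prod_le_prod (fun i _ => by positivity) fun i _ => ?_
        gcongr
        refine (Real.cosh_le_exp_half_sq _).trans (Real.exp_le_exp.2 ?_)
        have : a i ^ 2 ≤ 1 := (sq_le_one_iff_abs_le_one _).2 (ha i)
        nlinarith [sq_nonneg t]
    _ = _ := by
        rw [Finset.prod_const, Finset.card_univ, Fintype.card_fin, mul_pow, ← Real.exp_nat_mul]
        congr 2
        ring

theorem sum_exp_abs_signed_le {n : ℕ} (t : ℝ) (a : Fin n → ℝ) (ha : ∀ i, |a i| ≤ 1) :
    ∑ σ : Fin n → ℤˣ, Real.exp (t * |∑ i, ((σ i : ℤ) : ℝ) * a i|)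
      ≤ 2 * (2 ^ n * Real.exp (t ^ 2 * n / 2)) := by
  have h1 := sum_exp_signed_le t a ha
  have h2 := sum_exp_signed_le (-t) a ha
  rw [neg_sq] at h2
  have : ∑ σ : Fin n → ℤˣ, Real.exp (t * |∑ i, ((σ i : ℤ) : ℝ) * a i|)
      ≤ ∑ σ : Fin n → ℤˣ, (Real.exp (t * ∑ i, ((σ i : ℤ) : ℝ) * a i)
        + Real.exp (-t * ∑ i, ((σ i : ℤ) : ℝ) * a i)) := by
    refine Finset.sum_le_sum fun σ _ => ?_
    rcases abs_choice (∑ i, ((σ i : ℤ) : ℝ) * a i) with h | h <;> rw [h]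
    · linarith [Real.exp_pos (-t * ∑ i, ((σ i : ℤ) : ℝ) * a i)]
    · rw [neg_mul, mul_neg]
      linarith [Real.exp_pos (t * ∑ i, ((σ i : ℤ) : ℝ) * a i)]
  rw [Finset.sum_add_distrib] at this
  linarith

/-- Exponential moments of complex Rademacher sums. -/
theorem sum_exp_norm_signedSum_le {n : ℕ} {s : ℝ} (hs : 0 ≤ s) (a : Fin n → ℂ)
    (ha : ∀ i, ‖a i‖ ≤ 1) :
    ∑ σ : Fin n → ℤˣ, Real.exp (s * ‖signedSum σ a‖) ≤ 2 ^ n * (2 * Real.exp (2 * s ^ 2 * n)) := by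
  have h1 := sum_exp_abs_signed_le (2 * s) (fun i => (a i).re)
    fun i => (Complex.abs_re_le_norm _).trans (ha i)
  have h2 := sum_exp_abs_signed_le (2 * s) (fun i => (a i).im)
    fun i => (Complex.abs_im_le_norm _).trans (ha i)
  have : ∑ σ : Fin n → ℤˣ, Real.exp (s * ‖signedSum σ a‖)
      ≤ ∑ σ : Fin n → ℤˣ, (Real.exp (2 * s * |∑ i, ((σ i : ℤ) : ℝ) * (a i).re|)
        + Real.exp (2 * s * |∑ i, ((σ i : ℤ) : ℝ) * (a i).im|)) / 2 := by
    refine Finset.sum_le_sum fun σ _ => ?_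
    have hre : (signedSum σ a).re = ∑ i, ((σ i : ℤ) : ℝ) * (a i).re := by
      simp [signedSum, Complex.re_sum]
    have him : (signedSum σ a).im = ∑ i, ((σ i : ℤ) : ℝ) * (a i).im := by
      simp [signedSum, Complex.im_sum]
    have hn := Complex.norm_le_abs_re_add_abs_im (signedSum σ a)
    rw [← hre, ← him]
    calc Real.exp (s * ‖signedSum σ a‖)
        ≤ Real.exp (s * |(signedSum σ a).re|) * Real.exp (s * |(signedSum σ a).im|) := by
          rw [← Real.exp_add, ← mul_add]
          gcongr
      _ ≤ _ := by
          -- AM-GM separates real and imaginary parts at the cost of doubling the parameter `s`.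
          rw [mul_assoc 2 s, mul_assoc 2 s, two_mul, two_mul, Real.exp_add, Real.exp_add]
          nlinarith [sq_nonneg (Real.exp (s * |(signedSum σ a).re|)
            - Real.exp (s * |(signedSum σ a).im|))]
  rw [← Finset.sum_div, Finset.sum_add_distrib] at this
  refine this.trans ?_
  have he : (2 * s) ^ 2 * n / 2 = 2 * s ^ 2 * n := by ring
  rw [he] at h1 h2
  linarith

/-! ### Lattice points and their penalties. -/

theorem ENNReal.tsum_pi_prod {ι : Type*} (d : ℕ) (f : ι → ℝ≥0∞) :
    ∑' m : Fin d → ι, ∏ j, f (m j) = (∑' i, f i) ^ d := by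
  induction d with
  | zero => simp [tsum_fintype]
  | succ d ih =>
    rw [← (Fin.consEquiv fun _ : Fin (d + 1) => ι).tsum_eq, pow_succ', ← ih,
      ← ENNReal.tsum_mul_right]
    simp_rw [← ENNReal.tsum_mul_left]
    rw [← ENNReal.tsum_prod]
    simp [Fin.consEquiv, Fin.prod_univ_succ]

/-- `∑ (2 + |m|)⁻²` over the integers. -/
noncomputable def latticeConst : ℝ := ∑' m : ℤ, ((2 + |(m : ℝ)|) ^ 2)⁻¹

theorem summable_latticeConst : Summable fun m : ℤ => ((2 + |(m : ℝ)|) ^ 2)⁻¹ := by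
  -- The shift by `1/2` keeps the comparison series away from a zero denominator.
  have h := (Real.summable_one_div_int_add_rpow (1 / 2) 2).2 (by norm_num)
  refine h.of_nonneg_of_le (fun m => by positivity) fun m => ?_
  have h0 : (m : ℝ) + 1 / 2 ≠ 0 := by
    intro h
    have : (2 * m + 1 : ℝ) = 0 := by linarith
    have : 2 * m + 1 = 0 := by exact_mod_cast this
    omega
  rw [one_div, Real.rpow_two]
  have h1 : |(m : ℝ) + 1 / 2| ≤ 2 + |(m : ℝ)| :=
    (abs_add_le _ _).trans (by rw [abs_of_pos (by norm_num : (0 : ℝ) < 1 / 2)]; linarith)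
  have := abs_pos.2 h0
  gcongr

theorem latticeConst_nonneg : 0 ≤ latticeConst := tsum_nonneg fun m => by positivity

/-- The penalty of the lattice point `m` in the union bound. -/
noncomputable def latticePenalty {d : ℕ} (m : Fin d → ℤ) : ℝ :=
  (2 + latticeConst) * d + 2 * ∑ j, Real.log (2 + |(m j : ℝ)|)

theorem latticePenalty_nonneg {d : ℕ} (m : Fin d → ℤ) : 0 ≤ latticePenalty m := by
  have := latticeConst_nonneg
  have h : 0 ≤ ∑ j, Real.log (2 + |(m j : ℝ)|) :=
    Finset.sum_nonneg fun j _ => Real.log_nonneg (by linarith [abs_nonneg (m j : ℝ)])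
  unfold latticePenalty
  positivity

/-- The sum factorises over coordinates into `exp (-(2 + L) d) * L ^ d` with `L = latticeConst`, and
`L ≤ exp L`. The remaining `exp (-2d)` later cancels the exponential moment `exp (2 s² n)`. -/
theorem tsum_exp_neg_latticePenalty_le (d : ℕ) :
    ∑' m : Fin d → ℤ, ENNReal.ofReal (Real.exp (-latticePenalty m))
      ≤ ENNReal.ofReal (Real.exp (-(2 * d))) := by
  have hm : ∀ m : Fin d → ℤ, ENNReal.ofReal (Real.exp (-latticePenalty m))
      = ENNReal.ofReal (Real.exp (-((2 + latticeConst) * d))) *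
        ∏ j, ENNReal.ofReal (((2 + |(m j : ℝ)|) ^ 2)⁻¹) := fun m => by
    rw [← ENNReal.ofReal_prod_of_nonneg fun j _ => by positivity,
      ← ENNReal.ofReal_mul (by positivity)]
    congr 1
    rw [latticePenalty, neg_add, Real.exp_add, Finset.mul_sum, ← Finset.sum_neg_distrib,
      Real.exp_sum]
    congr 1
    refine Finset.prod_congr rfl fun j _ => ?_
    have : 0 < 2 + |(m j : ℝ)| := by positivity
    rw [Real.exp_neg, ← Nat.cast_two, ← Real.log_pow, Real.exp_log (by positivity)]
  simp_rw [hm]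
  rw [ENNReal.tsum_mul_left, ENNReal.tsum_pi_prod d fun m : ℤ =>
      ENNReal.ofReal (((2 + |(m : ℝ)|) ^ 2)⁻¹),
    ← ENNReal.ofReal_tsum_of_nonneg (fun m => by positivity) summable_latticeConst,
    ← latticeConst, ← ENNReal.ofReal_pow latticeConst_nonneg,
    ← ENNReal.ofReal_mul (by positivity)]
  refine ENNReal.ofReal_le_ofReal ?_
  have h : latticeConst ^ d ≤ Real.exp (latticeConst * d) := by
    rw [mul_comm, Real.exp_nat_mul]
    have := Real.add_one_le_exp latticeConst
    exact pow_le_pow_left₀ latticeConst_nonneg (by linarith) d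
  calc Real.exp (-((2 + latticeConst) * d)) * latticeConst ^ d
      ≤ Real.exp (-((2 + latticeConst) * d)) * Real.exp (latticeConst * d) := by gcongr
    _ = _ := by rw [← Real.exp_add]; congr 1; ring

/-- The penalty of a lattice point near `d • ξ` is at most a multiple of `d` times the weight. -/
theorem latticePenalty_le {d : ℕ} (hd : 1 ≤ d) (ξ : EuclideanSpace ℝ (Fin d)) (m : Fin d → ℤ)
    (hm : ∀ j, |(m j : ℝ)| ≤ |d * ξ j|) :
    latticePenalty m ≤ (4 + latticeConst) * d * logWeight ξ := by
  have hd' : (0 : ℝ) < d := by exact_mod_cast hd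
  have hξ : 0 ≤ ∑ j, |ξ j| := Finset.sum_nonneg fun j _ => abs_nonneg _
  have hw := one_le_logWeight ξ
  have hB := latticeConst_nonneg
  -- Jensen with uniform weights: the mean of `2 + |d * ξ j|` is exactly `2 + |ξ|₁`, which is why
  -- the mesh `1/d` fits the weight.
  have hJ := strictConcaveOn_log_Ioi.concaveOn.le_map_sum (t := Finset.univ)
    (w := fun _ : Fin d => (d : ℝ)⁻¹) (p := fun j => 2 + |d * ξ j|)
    (fun _ _ => by positivity) (by simp [hd'.ne'])
    (fun j _ => Set.mem_Ioi.2 (by positivity))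
  have hs : ∑ j : Fin d, (d : ℝ)⁻¹ • (2 + |d * ξ j|) = 2 + ∑ j, |ξ j| := by
    simp only [smul_eq_mul, mul_add, Finset.sum_add_distrib, abs_mul, abs_of_pos hd']
    simp [hd'.ne']
  rw [hs] at hJ
  simp only [smul_eq_mul, ← Finset.mul_sum] at hJ
  rw [inv_mul_le_iff₀ hd'] at hJ
  have h1 : ∑ j, Real.log (2 + |(m j : ℝ)|) ≤ ∑ j, Real.log (2 + |d * ξ j|) :=
    Finset.sum_le_sum fun j _ => Real.log_le_log (by positivity) (by linarith [hm j])
  have h2 : Real.log (2 + ∑ j, |ξ j|) ≤ logWeight ξ := by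
    rw [logWeight, Real.logb]
    rw [le_div_iff₀ (Real.log_pos (by norm_num))]
    have h3 : 0 ≤ Real.log (2 + ∑ j, |ξ j|) := Real.log_nonneg (by linarith)
    have h4 : Real.log 2 ≤ 1 := by linarith [Real.log_two_lt_d9]
    nlinarith
  unfold latticePenalty
  have h5 : (d : ℝ) * Real.log (2 + ∑ j, |ξ j|) ≤ d * logWeight ξ := by gcongr
  nlinarith [mul_nonneg (mul_nonneg (by linarith : 0 ≤ 2 + latticeConst) hd'.le)
    (by linarith : 0 ≤ logWeight ξ - 1)]

/-- Rounding is towards zero, so that the penalty of the lattice point is controlled by the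
frequency itself. -/
theorem exists_int_abs_le_abs_sub_le (y : ℝ) : ∃ m : ℤ, |(m : ℝ)| ≤ |y| ∧ |y - m| ≤ 1 := by
  rcases le_total 0 y with h | h
  · refine ⟨⌊y⌋, ?_, ?_⟩
    · have : (0 : ℝ) ≤ ⌊y⌋ := by exact_mod_cast Int.floor_nonneg.2 h
      rw [abs_of_nonneg this, abs_of_nonneg h]
      exact Int.floor_le y
    · rw [abs_le]
      constructor <;> linarith [Int.floor_le y, Int.lt_floor_add_one y]
  · refine ⟨⌈y⌉, ?_, ?_⟩
    · have : (⌈y⌉ : ℝ) ≤ 0 := by exact_mod_cast Int.ceil_le.2 (by simpa using h)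
      rw [abs_of_nonpos this, abs_of_nonpos h]
      linarith [Int.le_ceil y]
    · rw [abs_le]
      constructor <;> linarith [Int.le_ceil y, Int.ceil_lt_add_one y]

/-! ### Taylor expansion of plane waves. -/

/-- The plane waves `e^{2πi ξ·x_i}` at the sample points. -/
noncomputable def planeWave {d n : ℕ} (x : Fin n → EuclideanSpace ℝ (Fin d))
    (ξ : EuclideanSpace ℝ (Fin d)) (i : Fin n) : ℂ :=
  Complex.exp ((2 * Real.pi * ∑ j, ξ j * x i j : ℝ) * Complex.I)

/-- The coefficients of the Taylor expansion of a plane wave around the frequency `m / d`. -/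
noncomputable def taylorCoeff {d n : ℕ} (x : Fin n → EuclideanSpace ℝ (Fin d)) (m : Fin d → ℤ)
    {k : ℕ} (J : Fin k → Fin d) (i : Fin n) : ℂ :=
  Complex.exp ((2 * Real.pi * ∑ j, (m j / d : ℝ) * x i j : ℝ) * Complex.I) *
    ((∏ l, x i (J l) : ℝ) : ℂ)

theorem norm_taylorCoeff_le {d n : ℕ} {x : Fin n → EuclideanSpace ℝ (Fin d)}
    (hx : ∀ i j, |x i j| ≤ 1) (m : Fin d → ℤ) {k : ℕ} (J : Fin k → Fin d) (i : Fin n) :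
    ‖taylorCoeff x m J i‖ ≤ 1 := by
  rw [taylorCoeff, norm_mul, Complex.norm_exp_ofReal_mul_I, one_mul, Complex.norm_real,
    norm_prod]
  exact Finset.prod_le_one (fun _ _ => norm_nonneg _) fun l _ => hx i (J l)

/-- Taylor expansion of a signed sum of plane waves around the frequency `m / d`. -/
theorem hasSum_signedSum_planeWave {d n : ℕ} (hd : 1 ≤ d)
    (x : Fin n → EuclideanSpace ℝ (Fin d)) (σ : Fin n → ℤˣ) (ξ : EuclideanSpace ℝ (Fin d))
    (m : Fin d → ℤ) :
    HasSum (fun k : ℕ => (2 * Real.pi / d * Complex.I) ^ k / (k.factorial : ℂ) *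
        ∑ J : Fin k → Fin d, ((∏ l, (d * ξ (J l) - m (J l)) : ℝ) : ℂ) *
          signedSum σ (taylorCoeff x m J))
      (signedSum σ (planeWave x ξ)) := by
  have hd' : (d : ℂ) ≠ 0 := by exact_mod_cast (by omega : d ≠ 0)
  have key : ∀ i, HasSum (fun k : ℕ => ((σ i : ℤ) : ℂ) *
      (Complex.exp ((2 * Real.pi * ∑ j, (m j / d : ℝ) * x i j : ℝ) * Complex.I) *
        ((2 * Real.pi / d * Complex.I * ∑ j, ((d * ξ j - m j : ℝ) : ℂ) * x i j) ^ k
          / (k.factorial : ℂ)))) (((σ i : ℤ) : ℂ) * planeWave x ξ i) := fun i => by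
    have h := ((NormedSpace.expSeries_div_hasSum_exp
      (2 * Real.pi / d * Complex.I * ∑ j, ((d * ξ j - m j : ℝ) : ℂ) * x i j)).mul_left
      (Complex.exp ((2 * Real.pi * ∑ j, (m j / d : ℝ) * x i j : ℝ) * Complex.I))).mul_left
      ((σ i : ℤ) : ℂ)
    have he : planeWave x ξ i =
        Complex.exp ((2 * Real.pi * ∑ j, (m j / d : ℝ) * x i j : ℝ) * Complex.I) *
          Complex.exp (2 * Real.pi / d * Complex.I * ∑ j, ((d * ξ j - m j : ℝ) : ℂ) * x i j) := by
      rw [planeWave, ← Complex.exp_add]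
      congr 1
      push_cast
      simp only [Finset.mul_sum, Finset.sum_mul, ← Finset.sum_add_distrib]
      refine Finset.sum_congr rfl fun j _ => ?_
      field_simp
      ring
    rwa [← Complex.exp_eq_exp_ℂ, ← he] at h
  have hpow : ∀ (i : Fin n) (k : ℕ),
      (2 * Real.pi / d * Complex.I * ∑ j, ((d * ξ j - m j : ℝ) : ℂ) * x i j) ^ k =
        (2 * Real.pi / d * Complex.I) ^ k * ∑ J : Fin k → Fin d,
          ((∏ l, (d * ξ (J l) - m (J l)) : ℝ) : ℂ) * ((∏ l, x i (J l) : ℝ) : ℂ) := fun i k => by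
    rw [mul_pow, Fintype.sum_pow]
    simp_rw [Finset.prod_mul_distrib]
    push_cast
    rfl
  unfold signedSum
  simp only [hpow] at key
  convert hasSum_sum (s := Finset.univ) fun i _ => key i using 1
  funext k
  simp only [Finset.mul_sum, Finset.sum_div, taylorCoeff]
  rw [Finset.sum_comm]
  refine Finset.sum_congr rfl fun i _ => Finset.sum_congr rfl fun J _ => ?_
  ring

/-- The weight of a Taylor coefficient of order `k`. -/
noncomputable def taylorWeight (d k : ℕ) : ℝ≥0∞ :=
  ENNReal.ofReal ((2 * Real.pi / d) ^ k / k.factorial)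

/-- The `d ^ k` multi-indices of order `k` cancel the `d⁻ᵏ` coming from the mesh, leaving the
exponential series at `2π`. -/
theorem tsum_taylorWeight {d : ℕ} (hd : 1 ≤ d) :
    ∑' k, taylorWeight d k * (d : ℝ≥0∞) ^ k = ENNReal.ofReal (Real.exp (2 * Real.pi)) := by
  have hd' : (d : ℝ) ≠ 0 := by exact_mod_cast (by omega : d ≠ 0)
  have h := NormedSpace.expSeries_div_hasSum_exp (2 * Real.pi)
  rw [Real.exp_eq_exp_ℝ, ← h.tsum_eq, ENNReal.ofReal_tsum_of_nonneg (fun k => by positivity)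
    h.summable]
  refine tsum_congr fun k => ?_
  rw [taylorWeight, ← ENNReal.ofReal_natCast, ← ENNReal.ofReal_pow (by positivity),
    ← ENNReal.ofReal_mul (by positivity)]
  congr 1
  rw [div_pow]
  field_simp

theorem enorm_signedSum_planeWave_le {d n : ℕ} (hd : 1 ≤ d)
    (x : Fin n → EuclideanSpace ℝ (Fin d)) (σ : Fin n → ℤˣ) (ξ : EuclideanSpace ℝ (Fin d))
    (m : Fin d → ℤ) (hm : ∀ j, |d * ξ j - m j| ≤ 1) :
    ‖signedSum σ (planeWave x ξ)‖ₑ ≤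
      ∑' k, taylorWeight d k * ∑ J : Fin k → Fin d, ‖signedSum σ (taylorCoeff x m J)‖ₑ := by
  rw [← (hasSum_signedSum_planeWave hd x σ ξ m).tsum_eq]
  refine enorm_tsum_le_tsum_enorm.trans (ENNReal.tsum_le_tsum fun k => ?_)
  rw [enorm_mul]
  gcongr
  · rw [taylorWeight, ← ofReal_norm]
    refine ENNReal.ofReal_le_ofReal (le_of_eq ?_)
    simp [abs_of_pos Real.pi_pos]
  · refine (enorm_sum_le _ _).trans (Finset.sum_le_sum fun J _ => ?_)
    rw [enorm_mul]
    refine mul_le_of_le_one_left zero_le ?_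
    rw [← ofReal_norm, ENNReal.ofReal_le_one, Complex.norm_real, norm_prod]
    exact Finset.prod_le_one (fun _ _ => norm_nonneg _) fun l _ => hm (J l)

/-! ### The union bound over the lattice. -/

/-- The random variable that controls all signed sums of plane waves simultaneously. -/
noncomputable def waveExcess {d n : ℕ} (s : ℝ) (x : Fin n → EuclideanSpace ℝ (Fin d))
    (σ : Fin n → ℤˣ) : ℝ≥0∞ :=
  ∑' m : Fin d → ℤ, ∑' k, taylorWeight d k * ∑ J : Fin k → Fin d,
    ENNReal.ofReal (Real.exp (s * ‖signedSum σ (taylorCoeff x m J)‖ - latticePenalty m))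

theorem mul_enorm_signedSum_planeWave_le {d n : ℕ} (hd : 1 ≤ d) {s : ℝ} (hs : 0 ≤ s)
    (x : Fin n → EuclideanSpace ℝ (Fin d)) (σ : Fin n → ℤˣ) (ξ : EuclideanSpace ℝ (Fin d)) :
    ENNReal.ofReal s * ‖signedSum σ (planeWave x ξ)‖ₑ ≤
      ENNReal.ofReal (Real.exp (2 * Real.pi) * ((4 + latticeConst) * d * logWeight ξ))
        + waveExcess s x σ := by
  choose m hm1 hm2 using fun j => exists_int_abs_le_abs_sub_le (d * ξ j)
  calc ENNReal.ofReal s * ‖signedSum σ (planeWave x ξ)‖ₑ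
      ≤ ENNReal.ofReal s * ∑' k, taylorWeight d k * ∑ J : Fin k → Fin d,
          ‖signedSum σ (taylorCoeff x m J)‖ₑ := by
        gcongr
        exact enorm_signedSum_planeWave_le hd x σ ξ m hm2
    _ = ∑' k, taylorWeight d k * ∑ J : Fin k → Fin d,
          ENNReal.ofReal (s * ‖signedSum σ (taylorCoeff x m J)‖) := by
        rw [← ENNReal.tsum_mul_left]
        refine tsum_congr fun k => ?_
        rw [mul_left_comm, Finset.mul_sum]
        simp_rw [ENNReal.ofReal_mul hs, ofReal_norm]
    _ ≤ ∑' k, taylorWeight d k * ∑ J : Fin k → Fin d, (ENNReal.ofReal (latticePenalty m) +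
          ENNReal.ofReal (Real.exp (s * ‖signedSum σ (taylorCoeff x m J)‖ - latticePenalty m))) := by
        gcongr with k J
        rw [← ENNReal.ofReal_add (latticePenalty_nonneg m) (Real.exp_pos _).le]
        refine ENNReal.ofReal_le_ofReal ?_
        -- `y ≤ p + exp (y - p)`: the random excess no longer depends on `ξ` once summed over all
        -- `m`.
        linarith [Real.add_one_le_exp
          (s * ‖signedSum σ (taylorCoeff x m J)‖ - latticePenalty m)]
    _ = ENNReal.ofReal (Real.exp (2 * Real.pi) * latticePenalty m) +
          ∑' k, taylorWeight d k * ∑ J : Fin k → Fin d, ENNReal.ofReal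
            (Real.exp (s * ‖signedSum σ (taylorCoeff x m J)‖ - latticePenalty m)) := by
        simp_rw [Finset.sum_add_distrib, mul_add]
        rw [ENNReal.tsum_add, ENNReal.ofReal_mul (Real.exp_pos _).le, ← tsum_taylorWeight hd,
          ← ENNReal.tsum_mul_right]
        simp [mul_assoc]
    _ ≤ _ := by
        refine add_le_add (ENNReal.ofReal_le_ofReal ?_) ?_
        · gcongr
          exact latticePenalty_le hd ξ m hm1
        · exact ENNReal.le_tsum (f := fun m : Fin d → ℤ => ∑' k, taylorWeight d k *
            ∑ J : Fin k → Fin d, ENNReal.ofReal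
              (Real.exp (s * ‖signedSum σ (taylorCoeff x m J)‖ - latticePenalty m))) m

/-- With `s² n = d` every coefficient has exponential moment at most `2 exp (2d)`, which the
penalties cancel; only the total Taylor weight remains. -/
theorem sum_waveExcess_le {d n : ℕ} (hd : 1 ≤ d) {s : ℝ} (hs : 0 ≤ s) (hsn : s ^ 2 * n = d)
    {x : Fin n → EuclideanSpace ℝ (Fin d)} (hx : ∀ i j, |x i j| ≤ 1) :
    ∑ σ, waveExcess s x σ ≤ ENNReal.ofReal (2 ^ n * (2 * Real.exp (2 * Real.pi))) := by
  have hterm : ∀ (m : Fin d → ℤ) (k : ℕ) (J : Fin k → Fin d),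
      ∑ σ : Fin n → ℤˣ, ENNReal.ofReal
        (Real.exp (s * ‖signedSum σ (taylorCoeff x m J)‖ - latticePenalty m)) ≤
      ENNReal.ofReal (Real.exp (-latticePenalty m)) *
        ENNReal.ofReal (2 ^ n * (2 * Real.exp (2 * d))) := fun m k J => by
    rw [← ENNReal.ofReal_sum_of_nonneg fun _ _ => (Real.exp_pos _).le,
      ← ENNReal.ofReal_mul (Real.exp_pos _).le]
    refine ENNReal.ofReal_le_ofReal ?_
    have h := sum_exp_norm_signedSum_le hs (taylorCoeff x m J) (norm_taylorCoeff_le hx m J)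
    rw [mul_assoc, hsn] at h
    simp_rw [sub_eq_neg_add, Real.exp_add, ← Finset.mul_sum]
    gcongr
  calc ∑ σ, waveExcess s x σ
      = ∑' m : Fin d → ℤ, ∑' k, taylorWeight d k * ∑ J : Fin k → Fin d, ∑ σ : Fin n → ℤˣ,
          ENNReal.ofReal
            (Real.exp (s * ‖signedSum σ (taylorCoeff x m J)‖ - latticePenalty m)) := by
        simp_rw [waveExcess]
        rw [← Summable.tsum_finsetSum fun _ _ => ENNReal.summable]
        refine tsum_congr fun m => ?_
        rw [← Summable.tsum_finsetSum fun _ _ => ENNReal.summable]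
        refine tsum_congr fun k => ?_
        rw [← Finset.mul_sum, Finset.sum_comm]
    _ ≤ ∑' m : Fin d → ℤ, ∑' k, taylorWeight d k * ∑ _J : Fin k → Fin d,
          ENNReal.ofReal (Real.exp (-latticePenalty m)) *
            ENNReal.ofReal (2 ^ n * (2 * Real.exp (2 * d))) := by
        gcongr with m k J
        exact hterm m k J
    _ = (∑' m : Fin d → ℤ, ENNReal.ofReal (Real.exp (-latticePenalty m))) *
          (ENNReal.ofReal (Real.exp (2 * Real.pi)) *
            ENNReal.ofReal (2 ^ n * (2 * Real.exp (2 * d)))) := by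
        rw [← ENNReal.tsum_mul_right]
        refine tsum_congr fun m => ?_
        rw [← tsum_taylorWeight hd, ← ENNReal.tsum_mul_right, ← ENNReal.tsum_mul_left]
        refine tsum_congr fun k => ?_
        simp only [Finset.sum_const, Finset.card_univ, Fintype.card_pi_const, Fintype.card_fin,
          nsmul_eq_mul, Nat.cast_pow]
        ring
    _ ≤ ENNReal.ofReal (Real.exp (-(2 * d))) * (ENNReal.ofReal (Real.exp (2 * Real.pi)) *
            ENNReal.ofReal (2 ^ n * (2 * Real.exp (2 * d)))) := by
        gcongr
        exact tsum_exp_neg_latticePenalty_le d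
    _ = _ := by
        rw [← ENNReal.ofReal_mul (by positivity), ← ENNReal.ofReal_mul (by positivity),
          Real.exp_neg]
        congr 1
        field_simp

/-! ### Reduction from the ball to plane waves. -/

/-- A continuous function that gives an element of the log-Barron space is the inverse Fourier
integral of the function that gives its Fourier transform. -/
theorem eq_fourierInv_of_isGivenBy {d : ℕ} {f : 𝓢'(EuclideanSpace ℝ (Fin d), ℂ)}
    {u g : EuclideanSpace ℝ (Fin d) → ℂ} (hu : Continuous u) (hfu : IsGivenBy f u)
    (hg : IsGivenBy (𝓕 f) g) (hint : Integrable g) : u = 𝓕⁻ g := by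
  have hcont : Continuous (𝓕⁻ g) := by
    have h : Continuous (𝓕 g) := VectorFourier.fourierIntegral_continuous
      Real.continuous_fourierChar (by exact continuous_inner) hint
    have he : 𝓕⁻ g = fun x => 𝓕 g (-x) := funext fun x => Real.fourierInv_eq_fourier_neg g x
    rw [he]
    exact h.comp continuous_neg
  have hbdd : ∀ x, ‖𝓕⁻ g x‖ ≤ ∫ ξ, ‖g ξ‖ := fun x => by
    rw [Real.fourierInv_eq_fourier_neg]
    exact VectorFourier.norm_fourierIntegral_le_integral_norm _ _ _ _ _
  have hrep : IsGivenBy f (𝓕⁻ g) := by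
    refine ⟨hcont.locallyIntegrable, fun φ => ⟨?_, ?_⟩⟩
    · exact φ.integrable.mul_bdd hcont.aestronglyMeasurable (Filter.Eventually.of_forall hbdd)
    · have h1 : f φ = 𝓕 f (𝓕⁻ φ) := by simp
      rw [h1, (hg.2 _).2, SchwartzMap.fourierInv_coe]
      calc ∫ ξ, 𝓕⁻ (φ : EuclideanSpace ℝ (Fin d) → ℂ) ξ * g ξ
          = ∫ ξ, 𝓕 (fun x => φ (-x)) ξ * g ξ := by rw [Real.fourierInv_eq_fourier_comp_neg]
        _ = ∫ x, φ (-x) * 𝓕 g x := by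
          have := VectorFourier.integral_fourierIntegral_smul_eq_flip
            (μ := volume) (ν := volume) (L := innerₗ (EuclideanSpace ℝ (Fin d)))
            Real.continuous_fourierChar continuous_inner φ.integrable.comp_neg hint
          simp only [flip_innerₗ, smul_eq_mul] at this
          exact this
        _ = ∫ x, φ x * 𝓕⁻ g x := by
          rw [← integral_neg_eq_self (fun x => φ x * 𝓕⁻ g x)]
          simp [Real.fourierInv_eq_fourier_neg]
  exact (hu.ae_eq_iff_eq volume hcont).1 (hfu.ae_eq hrep)

/-- Functions in the log-Barron ball are Fourier integrals of integrable functions whose weighted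
integral is at most `Q`. -/
theorem exists_fourierInv_of_mem_logBarronBall {d : ℕ} {Q : ℝ}
    {u : EuclideanSpace ℝ (Fin d) → ℂ} (hu : u ∈ logBarronBall d Q) :
    ∃ g : EuclideanSpace ℝ (Fin d) → ℂ, Integrable g ∧ u = 𝓕⁻ g ∧
      ∫⁻ ξ, ENNReal.ofReal (logWeight ξ) * ‖g ξ‖ₑ ≤ ENNReal.ofReal Q := by
  obtain ⟨hc, f, hf, hQ, hfu⟩ := hu
  obtain ⟨g, hg⟩ : ∃ g, IsGivenBy (𝓕 f) g := by
    by_contra hne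
    push Not at hne
    have : logBarronNorm f = ⊤ := by simp [logBarronNorm, hne]
    exact (ne_of_lt hf) this
  rw [logBarronNorm_eq hg] at hQ
  have hint : Integrable g := by
    refine ⟨hg.1.aestronglyMeasurable, lt_of_le_of_lt (lintegral_mono fun ξ => ?_)
      (hQ.trans_lt ENNReal.ofReal_lt_top)⟩
    calc ‖g ξ‖ₑ = 1 * ‖g ξ‖ₑ := (one_mul _).symm
      _ ≤ _ := by
        gcongr
        simpa using one_le_logWeight ξ
  exact ⟨g, hint, eq_fourierInv_of_isGivenBy hc hfu hg hint, hQ⟩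

theorem signedSum_fourierInv {d n : ℕ} (x : Fin n → EuclideanSpace ℝ (Fin d)) (σ : Fin n → ℤˣ)
    {g : EuclideanSpace ℝ (Fin d) → ℂ} (hg : Integrable g) :
    signedSum σ (fun i => 𝓕⁻ g (x i)) = ∫ ξ, signedSum σ (planeWave x ξ) * g ξ := by
  have hwave : ∀ i, Continuous fun ξ => planeWave x ξ i := fun i => by
    unfold planeWave
    fun_prop
  have hint : ∀ i, Integrable fun ξ => planeWave x ξ i * g ξ := fun i =>
    hg.bdd_mul (hwave i).aestronglyMeasurable
      (Filter.Eventually.of_forall fun ξ => (Complex.norm_exp_ofReal_mul_I _).le)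
  simp only [signedSum, Finset.sum_mul, mul_assoc]
  rw [integral_finsetSum _ fun i _ => (hint i).const_mul _]
  refine Finset.sum_congr rfl fun i _ => ?_
  rw [integral_const_mul, Real.fourierInv_eq']
  congr 1
  refine integral_congr_ae (Filter.Eventually.of_forall fun ξ => ?_)
  simp [planeWave, PiLp.inner_apply, mul_comm]

theorem norm_signedSum_le_of_mem_logBarronBall {d n : ℕ} {Q : ℝ} (hQ : 0 ≤ Q)
    {u : EuclideanSpace ℝ (Fin d) → ℂ} (hu : u ∈ logBarronBall d Q)
    (x : Fin n → EuclideanSpace ℝ (Fin d)) (σ : Fin n → ℤˣ) {M : ℝ} (hM : 0 ≤ M)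
    (h : ∀ ξ, ‖signedSum σ (planeWave x ξ)‖ ≤ M * logWeight ξ) :
    ‖signedSum σ (fun i => u (x i))‖ ≤ M * Q := by
  obtain ⟨g, hg, rfl, hgQ⟩ := exists_fourierInv_of_mem_logBarronBall hu
  rw [signedSum_fourierInv x σ hg, ← ENNReal.ofReal_le_ofReal_iff (by positivity), ofReal_norm]
  calc ‖∫ ξ, signedSum σ (planeWave x ξ) * g ξ‖ₑ
      ≤ ∫⁻ ξ, ‖signedSum σ (planeWave x ξ) * g ξ‖ₑ := enorm_integral_le_lintegral_enorm _
    _ ≤ ∫⁻ ξ, ENNReal.ofReal M * (ENNReal.ofReal (logWeight ξ) * ‖g ξ‖ₑ) := by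
        refine lintegral_mono fun ξ => ?_
        rw [enorm_mul, ← mul_assoc, ← ENNReal.ofReal_mul hM, ← ofReal_norm (signedSum _ _)]
        gcongr
        exact h ξ
    _ = ENNReal.ofReal M * ∫⁻ ξ, ENNReal.ofReal (logWeight ξ) * ‖g ξ‖ₑ :=
        lintegral_const_mul' _ _ ENNReal.ofReal_ne_top
    _ ≤ _ := by
        rw [ENNReal.ofReal_mul hM]
        gcongr

/-! ### Averaging over the signs. -/

theorem signedAverages_le {d n : ℕ} {F : Set (EuclideanSpace ℝ (Fin d) → ℂ)}
    {x : Fin n → EuclideanSpace ℝ (Fin d)} {σ : Fin n → ℤˣ} {M : ℝ}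
    (h : ∀ u ∈ F, ‖signedSum σ (fun i => u (x i))‖ ≤ M) {r : ℝ}
    (hr : r ∈ signedAverages F x σ) : r ≤ (1 / n : ℝ) * M := by
  obtain ⟨u, hu, rfl⟩ := hr
  gcongr
  refine le_trans (le_of_eq ?_) ((Complex.re_le_norm _).trans (h u hu))
  simp [signedSum, Complex.re_sum]

theorem norm_signedSum_planeWave_le {d n : ℕ} (hd : 1 ≤ d) {s : ℝ} (hs : 0 < s)
    (x : Fin n → EuclideanSpace ℝ (Fin d)) (σ : Fin n → ℤˣ) (hfin : waveExcess s x σ ≠ ⊤)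
    (ξ : EuclideanSpace ℝ (Fin d)) :
    ‖signedSum σ (planeWave x ξ)‖ ≤
      s⁻¹ * (Real.exp (2 * Real.pi) * (4 + latticeConst) * d + (waveExcess s x σ).toReal)
        * logWeight ξ := by
  have hw := one_le_logWeight ξ
  have hB := latticeConst_nonneg
  have h := mul_enorm_signedSum_planeWave_le hd hs.le x σ ξ
  have hnn : 0 ≤ Real.exp (2 * Real.pi) * ((4 + latticeConst) * d * logWeight ξ) := by positivity
  rw [← ENNReal.ofReal_toReal hfin, ← ofReal_norm, ← ENNReal.ofReal_mul hs.le,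
    ← ENNReal.ofReal_add hnn ENNReal.toReal_nonneg,
    ENNReal.ofReal_le_ofReal_iff (add_nonneg hnn ENNReal.toReal_nonneg)] at h
  rw [mul_assoc, le_inv_mul_iff₀ hs]
  -- The excess carries no weight of its own; `1 ≤ logWeight ξ` supplies it.
  have := mul_le_mul_of_nonneg_left hw (ENNReal.toReal_nonneg (a := waveExcess s x σ))
  linarith

theorem empiricalRademacher_le {d n : ℕ} {F : Set (EuclideanSpace ℝ (Fin d) → ℂ)}
    {x : Fin n → EuclideanSpace ℝ (Fin d)} {M : (Fin n → ℤˣ) → ℝ} (hM : ∀ σ, 0 ≤ M σ)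
    (h : ∀ σ, ∀ r ∈ signedAverages F x σ, r ≤ M σ) :
    empiricalRademacher F x ≤ (1 / 2 ^ n : ℝ) * ∑ σ, M σ := by
  unfold empiricalRademacher
  gcongr with σ
  -- Nonnegativity of `M σ` covers the convention `sSup ∅ = 0`.
  exact Real.sSup_le (h σ) (hM σ)

theorem mainTheorem8 :
    ∃ C : ℝ, 0 < C ∧
      ∀ (d n : ℕ) (_ : 1 ≤ d) (_ : 1 ≤ n) (Q : ℝ) (_ : 0 ≤ Q)
        (x : Fin n → EuclideanSpace ℝ (Fin d)) (_ : ∀ i j, |x i j| ≤ 1),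
        (∀ σ : Fin n → ℤˣ, BddAbove (signedAverages (logBarronBall d Q) x σ)) ∧
          empiricalRademacher (logBarronBall d Q) x ≤ C * Q * Real.sqrt (d / n) := by
  have hB := latticeConst_nonneg
  refine ⟨Real.exp (2 * Real.pi) * (6 + latticeConst), by positivity, ?_⟩
  intro d n hd hn Q hQ x hx
  have hd' : (1 : ℝ) ≤ d := by exact_mod_cast hd
  have hn' : (1 : ℝ) ≤ n := by exact_mod_cast hn
  obtain ⟨s, hs_def⟩ : ∃ s, s = Real.sqrt (d / n) := ⟨_, rfl⟩
  have hs : 0 < s := hs_def ▸ Real.sqrt_pos.2 (by positivity)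
  have hsn : s ^ 2 * n = d := by
    rw [hs_def, Real.sq_sqrt (by positivity)]
    field_simp
  rw [← hs_def]
  have hsum := sum_waveExcess_le hd hs.le hsn hx
  -- There are finitely many sign vectors, so a finite total makes the excess finite for each of
  -- them; this gives boundedness for every `σ`.
  have hfin : ∀ σ, waveExcess s x σ ≠ ⊤ := fun σ =>
    ((Finset.single_le_sum (fun _ _ => zero_le) (Finset.mem_univ σ)).trans hsum).trans_lt
      ENNReal.ofReal_lt_top |>.ne
  have hsum' : ∑ σ, (waveExcess s x σ).toReal ≤ 2 ^ n * (2 * Real.exp (2 * Real.pi)) := by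
    rw [← ENNReal.toReal_sum fun σ _ => hfin σ]
    exact ENNReal.toReal_le_of_le_ofReal (by positivity) hsum
  set K : ℝ := Real.exp (2 * Real.pi) * (4 + latticeConst) * d with hK
  have hK0 : 0 ≤ K := by positivity
  have hM : ∀ σ, 0 ≤ s⁻¹ * (K + (waveExcess s x σ).toReal) := fun σ =>
    mul_nonneg (inv_nonneg.2 hs.le) (add_nonneg hK0 ENNReal.toReal_nonneg)
  have hav : ∀ σ, ∀ r ∈ signedAverages (logBarronBall d Q) x σ,
      r ≤ (1 / n : ℝ) * (s⁻¹ * (K + (waveExcess s x σ).toReal) * Q) := fun σ r hr =>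
    signedAverages_le (fun u hu => norm_signedSum_le_of_mem_logBarronBall hQ hu x σ (hM σ)
      (norm_signedSum_planeWave_le hd hs x σ (hfin σ))) hr
  refine ⟨fun σ => ⟨_, fun r hr => hav σ r hr⟩, ?_⟩
  refine (empiricalRademacher_le (fun σ => mul_nonneg (by positivity)
    (mul_nonneg (hM σ) hQ)) hav).trans ?_
  rw [← Finset.mul_sum, ← Finset.sum_mul, ← Finset.mul_sum, Finset.sum_add_distrib]
  have hcard : ∑ _σ : Fin n → ℤˣ, K = 2 ^ n * K := by simp
  rw [hcard]
  calc (1 / 2 ^ n : ℝ) * ((1 / n : ℝ) * (s⁻¹ * (2 ^ n * K + ∑ σ, (waveExcess s x σ).toReal) * Q))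
      ≤ (1 / 2 ^ n : ℝ) * ((1 / n : ℝ) *
          (s⁻¹ * (2 ^ n * K + 2 ^ n * (2 * Real.exp (2 * Real.pi))) * Q)) := by gcongr
    _ = (K + 2 * Real.exp (2 * Real.pi)) * Q * (s⁻¹ / n) := by field_simp
    -- As `1 ≤ d`, the mean excess `2 exp (2π)` is absorbed, turning `4` into `6`.
    _ ≤ (Real.exp (2 * Real.pi) * (6 + latticeConst) * d) * Q * (s⁻¹ / n) := by
        gcongr
        nlinarith [Real.exp_pos (2 * Real.pi)]
    _ = Real.exp (2 * Real.pi) * (6 + latticeConst) * Q * s := by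
        rw [← hsn]
        field_simp
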